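/- Let $U,V$ be linear subspaces of the Euclidean space $\mathbb{R}^n$. For a set $C\subseteq\mathbb{R}^n$ and $x\in\mathbb{R}^n$, let $P_C(x)$ denote the point of $C$ closest to $x$ (for the sets below it exists and is unique). For $\alpha\in(0,1]$, $\beta\in(0,1)$ and nonempty closed convex sets $A,B$, the averaged alternating modified reflections (AAMR) operator is $$T_{A,B,\alpha,\beta}:=(1-\alpha)I+\alpha(2\beta P_B-I)(2\beta P_A-I).$$ Let $$c_F:=\sup\{\langle u,v\rangle : u\in U\cap(U\cap V)^\perp,\ v\in V\cap(U\cap V)^\perp,\ \|u\|\le 1,\ \|v\|\le 1\}$$ be the cosine of the Friedrichs angle between $U$ and $V$ and, writing $t^+:=\max\{0,t\}$, put $$\widehat c_\beta:=\frac{\sqrt{(2\beta-1)^+}}{\beta},\qquad c(\alpha,\beta):=\begin{cases}\sqrt{\dfrac{\left((1-4\alpha\beta(1-\beta))^2-(1-2\alpha\beta)^2\right)^+}{4(1-\alpha)\alpha\beta^2}},&\alpha<1,\\ 0,&\alpha=1,\end{cases}$$ $$\gamma(T_{\alpha,\beta}):=\begin{cases}1-4\alpha\beta(1-\beta),& 0\le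 c_F<c(\alpha,\beta),\\ \sqrt{4(1-\alpha)\alpha\beta^2c_F^2+(1-2\alpha\beta)^2},& c(\alpha,\beta)\le c_F<\widehat c_\beta,\\ 1+2\alpha\beta\left(\beta c_F^2-1+c_F\sqrt{\beta^2c_F^2-2\beta+1}\right),&\widehat c_\beta\le c_F<1.\end{cases}$$ Let $\alpha\in(0,1]$, $\beta\in(0,1)$ and $z,x_0\in\mathbb{R}^n$, write $T:=T_{U-z,V-z,\alpha,\beta}$, and let $x_{k+1}=T(x_k)$ for $k=0,1,2,\ldots$. Then $\gamma(T_{\alpha,\beta})<1$, the set $\operatorname{Fix}T$ of fixed points of $T$ has a unique point $P_{\operatorname{Fix}T}(x_0)$ closest to $x_0$, and for every $\mu\in(\gamma(T_{\alpha,\beta}),1)$ the sequence $(x_k)$ converges R-linearly to $P_{\operatorname{Fix}T}(x_0)$ and the shadow sequence $(P_U(z+x_k))$ converges R-linearly to $P_{U\cap V}(z)$, both with rate $\mu$, in the sense that there is a positive integer $k_0$ (which may depend on all the data, including $\mu$ and $x_0$) such that $$\|P_U(z+x_k)-P_{U\cap V}(z)\|\le\|x_k-P_{\operatorname{Fix}T}(x_0)\|\le\mu^k\qquad\text{for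 all }k\ge k_0.$$ -/

import Mathlib

namespace AAMR

/-- `p` is a best approximation to `x` from `C`: it minimizes the distance to `x` over `C`. -/
def IsBestApprox {E : Type*} [NormedAddCommGroup E] (C : Set E) (x p : E) : Prop :=
  p ∈ C ∧ ∀ c ∈ C, ‖x - p‖ ≤ ‖x - c‖

/-- The projector `P_C`. It is meant for nonempty closed convex sets, where the best
approximation exists and is unique (`isBestApprox_projector`, `IsBestApprox.eq_projector`);
where there is no best approximation its value is unspecified. -/
noncomputable def projector {E : Type*} [NormedAddCommGroup E] (C : Set E) (x : E) : E :=
  Classical.epsilon (IsBestApprox C x)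

theorem isBestApprox_projector {E : Type*} [NormedAddCommGroup E] [InnerProductSpace ℝ E]
    [CompleteSpace E] {C : Set E} (hne : C.Nonempty) (hcl : IsClosed C) (hcv : Convex ℝ C)
    (x : E) : IsBestApprox C x (projector C x) := by
  obtain ⟨p, hp, hmin⟩ := exists_norm_eq_iInf_of_complete_convex hne hcl.isComplete hcv x
  refine Classical.epsilon_spec (p := IsBestApprox C x) ⟨p, hp, fun c hc => ?_⟩
  rw [hmin]
  exact ciInf_le ⟨0, by rintro _ ⟨w, rfl⟩; exact norm_nonneg _⟩ (⟨c, hc⟩ : C)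

theorem IsBestApprox.eq_projector {E : Type*} [NormedAddCommGroup E] [InnerProductSpace ℝ E]
    {C : Set E} (hcv : Convex ℝ C) {x p : E} (h : IsBestApprox C x p) :
    p = projector C x := by
  have h' : IsBestApprox C x (projector C x) :=
    Classical.epsilon_spec (p := IsBestApprox C x) ⟨p, h⟩
  set q := projector C x
  have hmid : (1 / 2 : ℝ) • p + (1 / 2 : ℝ) • q ∈ C :=
    hcv h.1 h'.1 (by norm_num) (by norm_num) (by norm_num)
  have h1 := h.2 _ hmid
  have h2 := h.2 _ h'.1
  have h3 := h'.2 _ h.1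
  have h4 := parallelogram_law_with_norm ℝ (x - p) (x - q)
  have h5 : (x - p) + (x - q) = (2 : ℝ) • (x - ((1 / 2 : ℝ) • p + (1 / 2 : ℝ) • q)) := by
    module
  have h6 : (x - p) - (x - q) = q - p := by abel
  rw [h5, h6, norm_smul, Real.norm_of_nonneg (by norm_num : (0 : ℝ) ≤ 2)] at h4
  have h7 : ‖x - p‖ = ‖x - q‖ := le_antisymm h2 h3
  have h8 : ‖q - p‖ = 0 := by
    nlinarith [norm_nonneg (q - p), norm_nonneg (x - p), h7]
  exact (sub_eq_zero.mp (norm_eq_zero.mp h8)).symm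

/-- The translate `C - z`. -/
def translate {E : Type*} [NormedAddCommGroup E] (C : Set E) (z : E) : Set E :=
  (fun c => c - z) '' C

/-- The modified reflection `2 β P_C - I`. -/
noncomputable def modifiedReflection {E : Type*} [NormedAddCommGroup E] [InnerProductSpace ℝ E]
    (C : Set E) (β : ℝ) (x : E) : E :=
  (2 * β) • projector C x - x

/-- The averaged alternating modified reflections operator
`T_{A,B,α,β} = (1 - α) I + α (2 β P_B - I) (2 β P_A - I)`. -/
noncomputable def aamr {E : Type*} [NormedAddCommGroup E] [InnerProductSpace ℝ E]
    (A B : Set E) (α β : ℝ) (x : E) : E :=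
  (1 - α) • x + α • modifiedReflection B β (modifiedReflection A β x)

/-- The cosine `c_F` of the Friedrichs angle between `U` and `V`. -/
noncomputable def friedrichsCos {E : Type*} [NormedAddCommGroup E] [InnerProductSpace ℝ E]
    (U V : Submodule ℝ E) : ℝ :=
  sSup {r : ℝ | ∃ u ∈ U ⊓ (U ⊓ V)ᗮ, ∃ v ∈ V ⊓ (U ⊓ V)ᗮ,
    ‖u‖ ≤ 1 ∧ ‖v‖ ≤ 1 ∧ r = inner ℝ u v}

/-- The threshold `ĉ_β = √((2 β - 1)⁺) / β`. -/
noncomputable def cHat (β : ℝ) : ℝ :=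
  √(max 0 (2 * β - 1)) / β

/-- The threshold `c(α, β)`. -/
noncomputable def cThreshold (α β : ℝ) : ℝ :=
  if α < 1 then
    √(max 0 ((1 - 4 * α * β * (1 - β)) ^ 2 - (1 - 2 * α * β) ^ 2)
      / (4 * (1 - α) * α * β ^ 2))
  else 0

/-- The rate `γ(T_{α,β})` as an explicit function of `α`, `β` and the cosine `c` of the
Friedrichs angle; the last branch is `ĉ_β ≤ c < 1`. -/
noncomputable def rate (α β c : ℝ) : ℝ :=
  if c < cThreshold α β then
    1 - 4 * α * β * (1 - β)
  else if c < cHat β then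
    √(4 * (1 - α) * α * β ^ 2 * c ^ 2 + (1 - 2 * α * β) ^ 2)
  else
    1 + 2 * α * β * (β * c ^ 2 - 1 + c * √(β ^ 2 * c ^ 2 - 2 * β + 1))

end AAMR

/-! `T` is affine with linear part `L = aamrLinear U V α β`. Its fixed points form a translate of
`Uᗮ ⊓ Vᗮ`, so if `p` is the one nearest to `x 0`, then `x k - p = L ^ k (x 0 - p)` with `x 0 - p ∈
(Uᗮ ⊓ Vᗮ)ᗮ = U ⊔ V`. It remains to bound orbits of `L` on `U ⊔ V` by `O(r ^ k)` for every `r` above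
the rate.

Vectors with such orbits form a subspace, so principal vectors suffice: those `u ∈ U` with `P_U P_V
u = σ u`, and symmetrically in `V` (`le_of_principal_vectors`). Either `u ∈ U ⊓ V`, where `L` is a
scalar, or `σ = c²` with `0 ≤ c ≤ c_F` (`principal_cosine_cases`), and the orbit obeys a two-term
recurrence whose characteristic roots are bounded by the rate (`principal_plane_roots`). The shadow
estimate holds because `P_U` is nonexpansive and `P_U (z + p) = P_{U ∩ V} z`. -/

namespace AAMR

/-! ### Scalar inequalities for the rate and its thresholds. -/

section Scalar

/-- This makes the last branch of `rate` apply to every `c ≥ cHat β`. -/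
theorem cThreshold_le_cHat {α β : ℝ} (hα₀ : 0 < α) (hβ₀ : 0 < β) (hβ₁ : β < 1) :
    cThreshold α β ≤ cHat β := by
  have hab : 0 < α * β := mul_pos hα₀ hβ₀
  unfold cThreshold cHat
  split_ifs with h
  · have hα : 0 < 1 - α := sub_pos.2 h
    rw [Real.sqrt_le_left (by positivity), div_pow, Real.sq_sqrt (le_max_left _ _),
      div_le_div_iff₀ (by positivity) (by positivity)]
    have hfac : (1 - 4 * α * β * (1 - β)) ^ 2 - (1 - 2 * α * β) ^ 2
        = (4 * (α * β)) * ((2 * β - 1) * (1 - α * (β * (3 - 2 * β)))) := by ring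
    rcases le_total β (1 / 2) with hb | hb
    · rw [max_eq_left, max_eq_left (by linarith)]
      · simp
      · have h1 : β * (3 - 2 * β) ≤ 1 := by nlinarith
        have h2 : 0 ≤ 1 - α * (β * (3 - 2 * β)) := by nlinarith
        rw [hfac]
        exact mul_nonpos_of_nonneg_of_nonpos (by positivity)
          (mul_nonpos_of_nonpos_of_nonneg (by linarith) h2)
    · have h1 : 0 ≤ 2 * β - 1 := by linarith
      rw [max_eq_right h1, max_mul_of_nonneg _ _ (by positivity), hfac]
      refine max_le (by rw [zero_mul]; positivity) ?_
      have h2 : (1 - β) * (1 + 2 * β) ≤ 1 := by nlinarith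
      have h3 : 0 ≤ 1 - α * ((1 - β) * (1 + 2 * β)) := by
        nlinarith [mul_pos (sub_pos.2 hβ₁) (by linarith : 0 < 1 + 2 * β)]
      -- This product is the gap between the two sides of the goal.
      have h4 : 0 ≤ (4 * α * β ^ 2) * ((2 * β - 1) * ((1 - β) *
          (1 - α * ((1 - β) * (1 + 2 * β))))) := by
        have := sub_pos.2 hβ₁
        positivity
      nlinarith
  · positivity

/-- The right-hand quantity governs the sign of the discriminant on a principal plane: `cHat β`
separates complex from real roots. -/
theorem cHat_le_iff {β c : ℝ} (hβ₀ : 0 < β) (hc : 0 ≤ c) :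
    cHat β ≤ c ↔ 0 ≤ β ^ 2 * c ^ 2 - 2 * β + 1 := by
  unfold cHat
  rw [div_le_iff₀ hβ₀, Real.sqrt_le_left (by positivity), max_le_iff]
  have : 0 ≤ (c * β) ^ 2 := sq_nonneg _
  constructor
  · rintro ⟨-, h⟩; nlinarith
  · intro h; exact ⟨this, by nlinarith⟩

/-- `c(α, β)` marks where the modulus `√δ` of the complex roots overtakes the eigenvalue on `U ⊓ V`.
-/
theorem le_sq_of_cThreshold_le {α β c : ℝ} (hα₀ : 0 < α) (hα₁ : α ≤ 1) (hβ₀ : 0 < β)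
    (hβ₁ : β < 1) (h : cThreshold α β ≤ c) :
    (1 - 4 * α * β * (1 - β)) ^ 2 ≤ 4 * (1 - α) * α * β ^ 2 * c ^ 2 + (1 - 2 * α * β) ^ 2 := by
  unfold cThreshold at h
  split_ifs at h with h1
  · have hα : 0 < 1 - α := sub_pos.2 h1
    have h2 := (Real.sqrt_le_left ((Real.sqrt_nonneg _).trans h)).1 h
    rw [div_le_iff₀ (by positivity)] at h2
    have := (le_max_right _ _).trans h2
    linarith
  · obtain rfl : α = 1 := le_antisymm hα₁ (not_lt.1 h1)
    have : 0 ≤ (1 - 2 * β) ^ 2 * (1 - (1 - 2 * β) ^ 2) :=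
      mul_nonneg (sq_nonneg _) (by nlinarith)
    linarith

theorem le_sq_of_lt_cThreshold {α β c : ℝ} (hα₀ : 0 < α) (hβ₀ : 0 < β) (hc : 0 ≤ c)
    (h : c < cThreshold α β) :
    4 * (1 - α) * α * β ^ 2 * c ^ 2 + (1 - 2 * α * β) ^ 2 ≤ (1 - 4 * α * β * (1 - β)) ^ 2 := by
  unfold cThreshold at h
  split_ifs at h with h1
  · have hα : 0 < 1 - α := sub_pos.2 h1
    have h2 := (Real.lt_sqrt hc).1 h
    rw [lt_div_iff₀ (by positivity)] at h2
    rcases lt_max_iff.1 h2 with h3 | h3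
    · have : 0 ≤ c ^ 2 * (4 * (1 - α) * α * β ^ 2) := by positivity
      linarith
    · linarith
  · linarith

theorem intersection_eigenvalue_nonneg {α β : ℝ} (hα₁ : α ≤ 1) (hβ₀ : 0 < β) (hβ₁ : β < 1) :
    0 ≤ 1 - 4 * α * β * (1 - β) := by
  nlinarith [mul_nonneg (sub_nonneg.2 hα₁) (mul_pos hβ₀ (sub_pos.2 hβ₁)).le,
    sq_nonneg (2 * β - 1)]

theorem intersection_eigenvalue_le_rate {α β c : ℝ} (hα₀ : 0 < α) (hα₁ : α ≤ 1) (hβ₀ : 0 < β)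
    (hβ₁ : β < 1) (hc : 0 ≤ c) : 1 - 4 * α * β * (1 - β) ≤ rate α β c := by
  unfold rate
  split_ifs with h1 h2
  · exact le_rfl
  · exact Real.le_sqrt_of_sq_le (le_sq_of_cThreshold_le hα₀ hα₁ hβ₀ hβ₁ (not_lt.1 h1))
  · have h3 := (cHat_le_iff hβ₀ hc).1 (not_lt.1 h2)
    have h4 : 0 ≤ c * √(β ^ 2 * c ^ 2 - 2 * β + 1) := by positivity
    have h5 : 0 ≤ β * c ^ 2 + 1 - 2 * β := by
      have : β ^ 2 * c ^ 2 ≤ β * c ^ 2 := by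
        have := mul_nonneg (mul_pos hβ₀ (sub_pos.2 hβ₁)).le (sq_nonneg c)
        linarith
      linarith
    have : 0 ≤ (2 * α * β) * (β * c ^ 2 + 1 - 2 * β + c * √(β ^ 2 * c ^ 2 - 2 * β + 1)) := by
      positivity
    linarith

theorem rate_nonneg {α β c : ℝ} (hα₀ : 0 < α) (hα₁ : α ≤ 1) (hβ₀ : 0 < β)
    (hβ₁ : β < 1) (hc : 0 ≤ c) : 0 ≤ rate α β c :=
  (intersection_eigenvalue_nonneg hα₁ hβ₀ hβ₁).trans
    (intersection_eigenvalue_le_rate hα₀ hα₁ hβ₀ hβ₁ hc)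

theorem rate_lt_one {α β c : ℝ} (hα₀ : 0 < α) (hα₁ : α ≤ 1) (hβ₀ : 0 < β)
    (hβ₁ : β < 1) (hc : 0 ≤ c) (hc₁ : c < 1) : rate α β c < 1 := by
  have hb : 0 < 1 - β := sub_pos.2 hβ₁
  have hab : 0 < α * β * (1 - β) := by positivity
  have hcc : c ^ 2 < 1 := by nlinarith
  unfold rate
  split_ifs with h1 h2
  · linarith
  · rw [Real.sqrt_lt' one_pos]
    have : 0 ≤ 4 * (1 - α) * α * β ^ 2 * (1 - c ^ 2) :=
      mul_nonneg (by have := sub_nonneg.2 hα₁; positivity) (by linarith)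
    nlinarith
  · have h3 := (cHat_le_iff hβ₀ hc).1 (not_lt.1 h2)
    have h4 : √(β ^ 2 * c ^ 2 - 2 * β + 1) ≤ 1 - β := by
      rw [Real.sqrt_le_left hb.le]
      nlinarith [sq_nonneg β]
    have h5 : c * √(β ^ 2 * c ^ 2 - 2 * β + 1) ≤ 1 * (1 - β) :=
      mul_le_mul hc₁.le h4 (Real.sqrt_nonneg _) zero_le_one
    have h6 : β * c ^ 2 < β := by nlinarith
    have : 0 < 2 * (α * β) := by positivity
    nlinarith

/-- The roots of `t² - 2 m t + δ`, the characteristic polynomial of the linear part of the AAMR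
operator on a principal plane of cosine `c`, are of modulus at most the rate. -/
theorem principal_plane_roots {α β c C : ℝ} (hα₀ : 0 < α) (hα₁ : α ≤ 1) (hβ₀ : 0 < β)
    (hβ₁ : β < 1) (hc : 0 ≤ c) (hcC : c ≤ C) {m δ : ℝ}
    (hm : m = 1 + 2 * α * β * (β * c ^ 2 - 1))
    (hδ : δ = 4 * (1 - α) * α * β ^ 2 * c ^ 2 + (1 - 2 * α * β) ^ 2) :
    (m ^ 2 < δ ∧ δ ≤ rate α β C ^ 2) ∨
      ∃ s, s ^ 2 = m ^ 2 - δ ∧ |m + s| ≤ rate α β C ∧ |m - s| ≤ rate α β C := by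
  have hC : 0 ≤ C := hc.trans hcC
  have hab : 0 < α * β := mul_pos hα₀ hβ₀
  have hsq : c ^ 2 ≤ C ^ 2 := by gcongr
  have hdisc : m ^ 2 - δ = (2 * α * β * c) ^ 2 * (β ^ 2 * c ^ 2 - 2 * β + 1) := by
    subst hm hδ; ring
  by_cases hD : 0 ≤ β ^ 2 * c ^ 2 - 2 * β + 1
  · right
    have hD' : β ^ 2 * c ^ 2 - 2 * β + 1 ≤ β ^ 2 * C ^ 2 - 2 * β + 1 := by gcongr
    have hCh := (cHat_le_iff hβ₀ hC).2 (hD.trans hD')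
    have hrate : rate α β C =
        1 + 2 * α * β * (β * C ^ 2 - 1 + C * √(β ^ 2 * C ^ 2 - 2 * β + 1)) := by
      unfold rate
      rw [if_neg (not_lt.2 ((cThreshold_le_cHat hα₀ hβ₀ hβ₁).trans hCh)),
        if_neg (not_lt.2 hCh)]
    set q := √(β ^ 2 * c ^ 2 - 2 * β + 1) with hq
    have hq0 : 0 ≤ q := Real.sqrt_nonneg _
    have hqq : q ^ 2 = β ^ 2 * c ^ 2 - 2 * β + 1 := Real.sq_sqrt hD
    have hs0 : 0 ≤ 2 * α * β * c * q := by positivity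
    have hle : m + 2 * α * β * c * q ≤ rate α β C := by
      have h1 : c * q ≤ C * √(β ^ 2 * C ^ 2 - 2 * β + 1) :=
        mul_le_mul hcC (Real.sqrt_le_sqrt hD') hq0 hC
      have h2 : β * c ^ 2 ≤ β * C ^ 2 := by gcongr
      have : 0 ≤ (2 * (α * β)) * ((β * C ^ 2 - β * c ^ 2) +
          (C * √(β ^ 2 * C ^ 2 - 2 * β + 1) - c * q)) :=
        mul_nonneg (by positivity) (by linarith)
      rw [hrate, hm]
      linarith
    -- The smaller root is nonnegative, so the larger one, increasing in the cosine, dominates in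
    -- modulus.
    have hge : 0 ≤ m - 2 * α * β * c * q := by
      have : m - 2 * α * β * c * q = (1 - α) + α * (q - β * c) ^ 2 := by
        rw [hm]; linear_combination (-α) * hqq
      rw [this]
      have := sub_nonneg.2 hα₁
      positivity
    refine ⟨2 * α * β * c * q, ?_, ?_, ?_⟩
    · rw [hdisc, mul_pow, hqq]
    · rw [abs_of_nonneg (by linarith)]; exact hle
    · rw [abs_of_nonneg hge]; linarith
  -- With negative `β² c² - 2 β + 1`, the modulus is `√δ`, and `δ` is nondecreasing in the cosine.
  · have hδC : δ ≤ 4 * (1 - α) * α * β ^ 2 * C ^ 2 + (1 - 2 * α * β) ^ 2 := by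
      have := sub_nonneg.2 hα₁
      rw [hδ]; gcongr
    have hδr : δ ≤ rate α β C ^ 2 := by
      unfold rate
      split_ifs with h1 h2
      · exact hδC.trans (le_sq_of_lt_cThreshold hα₀ hβ₀ hC h1)
      · rw [Real.sq_sqrt]
        · exact hδC
        · have := sub_nonneg.2 hα₁
          positivity
      · have h3 := (cHat_le_iff hβ₀ hC).1 (not_lt.1 h2)
        have h4 : 0 ≤ C * √(β ^ 2 * C ^ 2 - 2 * β + 1) := by positivity
        -- `1 - 2 α (1 - β)` is the double root at the critical cosine `β² c² = 2 β - 1`; it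
        -- separates `√δ` from the last branch.
        have h5 : 1 - 2 * α * (1 - β) ≤
            1 + 2 * α * β * (β * C ^ 2 - 1 + C * √(β ^ 2 * C ^ 2 - 2 * β + 1)) := by
          have h6 := mul_nonneg hα₀.le h3
          have h7 := mul_nonneg hab.le h4
          linarith
        have hβ : 1 / 2 < β := by nlinarith [sq_nonneg (β * c)]
        have h8 : 0 ≤ 1 - 2 * α * (1 - β) := by nlinarith
        refine le_trans ?_ (pow_le_pow_left₀ h8 h5 2)
        have h9 : 0 ≤ (4 * (1 - α) * α) * (-(β ^ 2 * c ^ 2 - 2 * β + 1)) :=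
          mul_nonneg (by have := sub_nonneg.2 hα₁; positivity) (by linarith)
        rw [hδ]
        linarith
    -- At `c = 0` the factor `c²` kills the discriminant: a real double root.
    rcases hc.eq_or_lt with rfl | hc0
    · right
      have habs : |m| ≤ rate α β C := by
        refine abs_le_of_sq_le_sq ?_ (rate_nonneg hα₀ hα₁ hβ₀ hβ₁ hC)
        have : m ^ 2 = δ := by simpa [sub_eq_zero] using hdisc
        rw [this]; exact hδr
      exact ⟨0, by rw [hdisc]; ring, by simpa using habs, by simpa using habs⟩
    · left
      refine ⟨?_, hδr⟩
      have : 0 < (2 * α * β * c) ^ 2 * (-(β ^ 2 * c ^ 2 - 2 * β + 1)) :=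
        mul_pos (by positivity) (by linarith)
      linarith

end Scalar

/-! ### Geometric decay of linear recurrences. -/

section Decay

variable {E : Type*} [NormedAddCommGroup E]

/-- The strict gap `r - |l|` absorbs a forcing term of order `r ^ k`, so double roots need no
polynomial factor. -/
theorem exists_geometric_bound_of_affine_recurrence [NormedSpace ℝ E] {a : ℕ → E} {l r C : ℝ}
    (hl : |l| < r) (h : ∀ k, ‖a (k + 1) - l • a k‖ ≤ C * r ^ k) :
    ∃ D, ∀ k, ‖a k‖ ≤ D * r ^ k := by
  have hr : 0 < r := (abs_nonneg l).trans_lt hl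
  refine ⟨max ‖a 0‖ (C / (r - |l|)), fun k => ?_⟩
  set D := max ‖a 0‖ (C / (r - |l|)) with hD
  have hCD : C ≤ D * (r - |l|) := (div_le_iff₀ (sub_pos.2 hl)).1 (le_max_right _ _)
  induction k with
  | zero => simp [hD]
  | succ k ih =>
    calc ‖a (k + 1)‖ = ‖(a (k + 1) - l • a k) + l • a k‖ := by simp
      _ ≤ ‖a (k + 1) - l • a k‖ + |l| * ‖a k‖ := by
        simpa [norm_smul] using norm_add_le (a (k + 1) - l • a k) (l • a k)
      _ ≤ D * (r - |l|) * r ^ k + |l| * (D * r ^ k) := by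
        gcongr
        exact (h k).trans (by gcongr)
      _ = D * r ^ (k + 1) := by ring

variable [InnerProductSpace ℝ E]

/-- The energy `‖a (k+1) - m a k‖² + (δ - m²) ‖a k‖²` is multiplied by exactly `δ` at each step. -/
theorem exists_geometric_bound_of_complex_roots {a : ℕ → E} {m δ r : ℝ} (hr : 0 ≤ r)
    (hm : m ^ 2 < δ) (hδ : δ ≤ r ^ 2)
    (h : ∀ k, a (k + 2) = (2 * m) • a (k + 1) - δ • a k) :
    ∃ D, ∀ k, ‖a k‖ ≤ D * r ^ k := by
  have hs : 0 < δ - m ^ 2 := sub_pos.2 hm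
  have hδ₀ : 0 ≤ δ := (sq_nonneg m).trans hm.le
  have energy : ∀ k, ‖a (k + 1) - m • a k‖ ^ 2 + (δ - m ^ 2) * ‖a k‖ ^ 2
      = δ ^ k * (‖a 1 - m • a 0‖ ^ 2 + (δ - m ^ 2) * ‖a 0‖ ^ 2) := by
    intro k
    induction k with
    | zero => simp
    | succ k ih =>
      rw [pow_succ' δ, mul_assoc, ← ih, h k]
      simp only [← real_inner_self_eq_norm_sq, inner_sub_left, inner_sub_right,
        inner_smul_left, inner_smul_right, real_inner_comm (a (k + 1)) (a k)]
      simp only [conj_trivial]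
      ring
  set N := ‖a 1 - m • a 0‖ ^ 2 + (δ - m ^ 2) * ‖a 0‖ ^ 2 with hN
  have hN₀ : 0 ≤ N := by positivity
  refine ⟨√(N / (δ - m ^ 2)), fun k => ?_⟩
  refine le_of_sq_le_sq ?_ (by positivity)
  rw [mul_pow, Real.sq_sqrt (by positivity), div_mul_eq_mul_div, le_div_iff₀ hs]
  calc ‖a k‖ ^ 2 * (δ - m ^ 2) ≤ δ ^ k * N := by
        rw [← energy k]; nlinarith [sq_nonneg ‖a (k + 1) - m • a k‖]
    _ ≤ (r ^ 2) ^ k * N := by gcongr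
    _ = N * (r ^ k) ^ 2 := by ring

theorem exists_geometric_bound_of_roots {a : ℕ → E} {m δ r : ℝ} (hr : 0 ≤ r)
    (hroots : (m ^ 2 < δ ∧ δ ≤ r ^ 2) ∨ ∃ s, s ^ 2 = m ^ 2 - δ ∧ |m + s| < r ∧ |m - s| < r)
    (h : ∀ k, a (k + 2) = (2 * m) • a (k + 1) - δ • a k) :
    ∃ D, ∀ k, ‖a k‖ ≤ D * r ^ k := by
  rcases hroots with ⟨h1, h2⟩ | ⟨s, hs, h1, h2⟩
  · exact exists_geometric_bound_of_complex_roots hr h1 h2 h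
  -- Factoring the recurrence: `a (k+1) - (m - s) a k` is geometric of ratio `m + s`.
  · obtain ⟨C, hC⟩ := exists_geometric_bound_of_affine_recurrence
      (a := fun k => a (k + 1) - (m - s) • a k) (C := 0) h1 (fun k => by
        have : a (k + 1 + 1) - (m - s) • a (k + 1) - (m + s) • (a (k + 1) - (m - s) • a k) = 0 := by
          have hδ : δ = m ^ 2 - s ^ 2 := by linarith
          rw [h k, hδ]; module
        simp [this])
    exact exists_geometric_bound_of_affine_recurrence h2 hC

/-- The vectors whose orbit under `L` is `O(r ^ k)`. -/
def decaySubmodule (L : E →ₗ[ℝ] E) (r : ℝ) : Submodule ℝ E where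
  carrier := {w | ∃ C, ∀ k : ℕ, ‖(L ^ k) w‖ ≤ C * r ^ k}
  add_mem' := by
    rintro v w ⟨C, hC⟩ ⟨D, hD⟩
    refine ⟨C + D, fun k => ?_⟩
    rw [map_add, add_mul]
    exact norm_add_le_of_le (hC k) (hD k)
  zero_mem' := ⟨0, by simp⟩
  smul_mem' := by
    rintro c w ⟨C, hC⟩
    refine ⟨|c| * C, fun k => ?_⟩
    rw [map_smul, norm_smul, Real.norm_eq_abs, mul_assoc]
    exact mul_le_mul_of_nonneg_left (hC k) (abs_nonneg c)

theorem mem_decaySubmodule_of_eigenvector {L : E →ₗ[ℝ] E} {l r : ℝ} {w : E} (hl : |l| < r)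
    (h : L w = l • w) : w ∈ decaySubmodule L r :=
  exists_geometric_bound_of_affine_recurrence (C := 0) hl fun k => by
    rw [pow_succ, Module.End.mul_apply, h, map_smul]; simp

theorem mem_decaySubmodule_of_roots {L : E →ₗ[ℝ] E} {m δ r : ℝ} {w : E} (hr : 0 ≤ r)
    (hroots : (m ^ 2 < δ ∧ δ ≤ r ^ 2) ∨ ∃ s, s ^ 2 = m ^ 2 - δ ∧ |m + s| < r ∧ |m - s| < r)
    (h : L (L w) = (2 * m) • L w - δ • w) : w ∈ decaySubmodule L r :=
  exists_geometric_bound_of_roots hr hroots fun k => by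
    rw [pow_add, pow_succ L k, Module.End.mul_apply, Module.End.mul_apply, pow_two,
      Module.End.mul_apply, h, map_sub, map_smul, map_smul]

end Decay

/-! ### The Friedrichs angle. -/

section Friedrichs

variable {E : Type*} [NormedAddCommGroup E] [InnerProductSpace ℝ E]

theorem friedrichsCos_comm (U V : Submodule ℝ E) : friedrichsCos U V = friedrichsCos V U := by
  unfold friedrichsCos
  congr 1
  ext r
  constructor
  · rintro ⟨u, hu, v, hv, h1, h2, rfl⟩
    exact ⟨v, by rwa [inf_comm V U], u, by rwa [inf_comm V U], h2, h1, real_inner_comm _ _⟩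
  · rintro ⟨u, hu, v, hv, h1, h2, rfl⟩
    exact ⟨v, by rwa [inf_comm U V], u, by rwa [inf_comm U V], h2, h1, real_inner_comm _ _⟩

theorem inner_le_friedrichsCos {U V : Submodule ℝ E} {u v : E} (hu : u ∈ U ⊓ (U ⊓ V)ᗮ)
    (hv : v ∈ V ⊓ (U ⊓ V)ᗮ) (hu₁ : ‖u‖ ≤ 1) (hv₁ : ‖v‖ ≤ 1) :
    inner ℝ u v ≤ friedrichsCos U V := by
  refine le_csSup ⟨1, ?_⟩ ⟨u, hu, v, hv, hu₁, hv₁, rfl⟩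
  rintro _ ⟨u, -, v, -, hu, hv, rfl⟩
  exact (real_inner_le_norm u v).trans (mul_le_one₀ hu (norm_nonneg v) hv)

theorem friedrichsCos_nonneg (U V : Submodule ℝ E) : 0 ≤ friedrichsCos U V := by
  simpa using inner_le_friedrichsCos (zero_mem (U ⊓ (U ⊓ V)ᗮ)) (zero_mem (V ⊓ (U ⊓ V)ᗮ))
    (by simp) (by simp)

/-- By compactness the supremum is attained; a value at least `1` would force `u = v`, a vector of
`U ⊓ V` orthogonal to itself. -/
theorem friedrichsCos_lt_one [FiniteDimensional ℝ E] (U V : Submodule ℝ E) :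
    friedrichsCos U V < 1 := by
  have hcl (W : Submodule ℝ E) : IsCompact (Metric.closedBall (0 : E) 1 ∩ (W : Set E)) :=
    (isCompact_closedBall (0 : E) 1).inter_right W.closed_of_finiteDimensional
  have hset : {r : ℝ | ∃ u ∈ U ⊓ (U ⊓ V)ᗮ, ∃ v ∈ V ⊓ (U ⊓ V)ᗮ,
      ‖u‖ ≤ 1 ∧ ‖v‖ ≤ 1 ∧ r = inner ℝ u v} =
      (fun p : E × E => inner ℝ p.1 p.2) ''
        ((Metric.closedBall (0 : E) 1 ∩ ((U ⊓ (U ⊓ V)ᗮ : Submodule ℝ E) : Set E)) ×ˢ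
          (Metric.closedBall (0 : E) 1 ∩ ((V ⊓ (U ⊓ V)ᗮ : Submodule ℝ E) : Set E))) := by
    ext r
    constructor
    · rintro ⟨u, hu, v, hv, h1, h2, rfl⟩
      exact ⟨(u, v), ⟨⟨by simpa using h1, hu⟩, ⟨by simpa using h2, hv⟩⟩, rfl⟩
    · rintro ⟨⟨u, v⟩, ⟨⟨h1, hu⟩, ⟨h2, hv⟩⟩, rfl⟩
      exact ⟨u, hu, v, hv, by simpa using h1, by simpa using h2, rfl⟩
  have hcomp := ((hcl (U ⊓ (U ⊓ V)ᗮ)).prod (hcl (V ⊓ (U ⊓ V)ᗮ))).image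
    (f := fun p : E × E => inner ℝ p.1 p.2) (by fun_prop)
  rw [← hset] at hcomp
  obtain ⟨u, hu, v, hv, hu₁, hv₁, huv⟩ := hcomp.sSup_mem
    ⟨0, 0, zero_mem _, 0, zero_mem _, by simp, by simp, by simp⟩
  unfold friedrichsCos
  rw [huv]
  by_contra! hge
  have h1 := norm_sub_sq_real u v
  have h2 : ‖u - v‖ = 0 := by
    nlinarith [norm_nonneg u, norm_nonneg v, norm_nonneg (u - v)]
  obtain rfl : u = v := sub_eq_zero.1 (norm_eq_zero.1 h2)
  have h3 : inner ℝ u u = (0 : ℝ) :=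
    Submodule.inner_right_of_mem_orthogonal (K := U ⊓ V) ⟨hu.1, hv.1⟩ hu.2
  linarith

end Friedrichs

/-! ### The linear part on principal vectors. -/

section Linear

variable {E : Type*} [NormedAddCommGroup E] [InnerProductSpace ℝ E]

theorem starProjection_starProjection (U : Submodule ℝ E) [U.HasOrthogonalProjection] (x : E) :
    U.starProjection (U.starProjection x) = U.starProjection x :=
  Submodule.starProjection_eq_self_iff.2 (Submodule.starProjection_apply_mem U x)

/-- The linear part `(1 - α) I + α (2 β P_V - I) (2 β P_U - I)` of the AAMR operator. -/
noncomputable def aamrLinear (U V : Submodule ℝ E) [U.HasOrthogonalProjection]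
    [V.HasOrthogonalProjection] (α β : ℝ) : E →ₗ[ℝ] E :=
  (1 - α) • LinearMap.id + α •
    (((2 * β) • (V.starProjection : E →ₗ[ℝ] E) - LinearMap.id) ∘ₗ
      ((2 * β) • (U.starProjection : E →ₗ[ℝ] E) - LinearMap.id))

variable {U V : Submodule ℝ E} [U.HasOrthogonalProjection] [V.HasOrthogonalProjection] {α β : ℝ}

theorem aamrLinear_apply (x : E) : aamrLinear U V α β x =
    (1 - α) • x + α • ((2 * β) • V.starProjection ((2 * β) • U.starProjection x - x) -
      ((2 * β) • U.starProjection x - x)) := rfl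

theorem aamrLinear_apply_of_mem_inf {w : E} (hw : w ∈ U ⊓ V) :
    aamrLinear U V α β w = (1 - 4 * α * β * (1 - β)) • w := by
  rw [aamrLinear_apply, map_sub, map_smul, Submodule.starProjection_eq_self_iff.2 hw.1,
    Submodule.starProjection_eq_self_iff.2 hw.2]
  module

/-- The span of `u` and `P_V u` is invariant; this is Cayley–Hamilton for the 2×2 matrix of `L` on
these generators. -/
theorem aamrLinear_quadratic_left {u : E} {σ : ℝ} (hu : u ∈ U)
    (h : U.starProjection (V.starProjection u) = σ • u) :
    aamrLinear U V α β (aamrLinear U V α β u) =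
      (2 * (1 + 2 * α * β * (β * σ - 1))) • aamrLinear U V α β u -
        (4 * (1 - α) * α * β ^ 2 * σ + (1 - 2 * α * β) ^ 2) • u := by
  have hu' : U.starProjection u = u := Submodule.starProjection_eq_self_iff.2 hu
  simp only [aamrLinear_apply, map_sub, map_smul, map_add, hu', h,
    starProjection_starProjection]
  module

theorem aamrLinear_quadratic_right {v : E} {σ : ℝ} (hv : v ∈ V)
    (h : V.starProjection (U.starProjection v) = σ • v) :
    aamrLinear U V α β (aamrLinear U V α β v) =
      (2 * (1 + 2 * α * β * (β * σ - 1))) • aamrLinear U V α β v -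
        (4 * (1 - α) * α * β ^ 2 * σ + (1 - 2 * α * β) ^ 2) • v := by
  have hv' : V.starProjection v = v := Submodule.starProjection_eq_self_iff.2 hv
  simp only [aamrLinear_apply, map_sub, map_smul, map_add, hv', h,
    starProjection_starProjection]
  module

theorem aamrLinear_apply_of_mem_orthogonal {w : E} (hU : w ∈ Uᗮ) (hV : w ∈ Vᗮ) :
    aamrLinear U V α β w = w := by
  rw [aamrLinear_apply, map_sub, map_smul, (Submodule.starProjection_apply_eq_zero_iff _).2 hU,
    (Submodule.starProjection_apply_eq_zero_iff _).2 hV, map_zero]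
  module

/-- With `p = P_U w`, the fixed-point equation reads `p = 2 β P_V p - P_V w`. Hence `p ∈ V`, and
pairing with `p` gives `(1 - β) ‖p‖² = 0`. -/
theorem mem_orthogonal_of_aamrLinear_eq_self (hα : 0 < α) (hβ₀ : 0 < β) (hβ₁ : β < 1) {w : E}
    (h : aamrLinear U V α β w = w) : w ∈ Uᗮ ⊓ Vᗮ := by
  rw [aamrLinear_apply, map_sub, map_smul] at h
  set p := U.starProjection w with hp
  have h1 : (2 * α * β) • p =
      (2 * α * β) • ((2 * β) • V.starProjection p - V.starProjection w) := by
    rw [← sub_eq_zero]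
    rw [← sub_eq_zero] at h
    rw [← neg_eq_zero, ← h]
    module
  have h2 : p = (2 * β) • V.starProjection p - V.starProjection w :=
    smul_right_injective E (by positivity : 2 * α * β ≠ 0) h1
  have hpU : p ∈ U := Submodule.starProjection_apply_mem U w
  have hpV : p ∈ V := by
    rw [h2]
    exact V.sub_mem (V.smul_mem _ (Submodule.starProjection_apply_mem V p))
      (Submodule.starProjection_apply_mem V w)
  rw [Submodule.starProjection_eq_self_iff.2 hpV] at h2
  have hinner : inner ℝ p (V.starProjection w) = inner ℝ p p := by
    have e1 : inner ℝ (w - V.starProjection w) p = (0 : ℝ) :=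
      Submodule.starProjection_inner_eq_zero w p hpV
    have e2 : inner ℝ (w - p) p = (0 : ℝ) :=
      Submodule.starProjection_inner_eq_zero w p hpU
    rw [inner_sub_left] at e1 e2
    rw [real_inner_comm]; linarith
  have h3 := congrArg (fun y => (inner ℝ p y : ℝ)) h2
  simp only [inner_sub_right, inner_smul_right, hinner] at h3
  have h4 : inner ℝ p p = (0 : ℝ) := by
    have : (1 - β) * inner ℝ p p = (0 : ℝ) := by linarith
    exact (mul_eq_zero.1 this).resolve_left (by linarith)
  have h5 : p = 0 := inner_self_eq_zero.1 h4
  rw [h5] at h2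
  have h6 : V.starProjection w = 0 := by simpa using h2
  exact ⟨(Submodule.starProjection_apply_eq_zero_iff _).1 h5,
    (Submodule.starProjection_apply_eq_zero_iff _).1 h6⟩

/-- Here `σ = ‖P_V u‖² / ‖u‖²`. If `σ ≠ 1`, then `⟪y, u⟫ = σ ⟪y, u⟫` on `U ⊓ V` makes `u` and `P_V
u` orthogonal to it; for `σ > 0` their normalizations have inner product `√σ`. -/
theorem principal_cosine_cases {u : E} {σ : ℝ} (hu : u ∈ U) (hu₀ : u ≠ 0)
    (h : U.starProjection (V.starProjection u) = σ • u) :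
    u ∈ U ⊓ V ∨ ∃ c, 0 ≤ c ∧ c ≤ friedrichsCos U V ∧ σ = c ^ 2 := by
  set q := V.starProjection u with hq
  have hqV : q ∈ V := Submodule.starProjection_apply_mem V u
  have hpos : 0 < ‖u‖ := norm_pos_iff.2 hu₀
  have huq : inner ℝ u q = σ * ‖u‖ ^ 2 := by
    have e : inner ℝ (q - U.starProjection q) u = (0 : ℝ) :=
      Submodule.starProjection_inner_eq_zero q u hu
    rw [h, inner_sub_left, inner_smul_left, real_inner_self_eq_norm_sq] at e
    rw [real_inner_comm]
    simpa [sub_eq_zero] using e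
  have hqq : ‖q‖ ^ 2 = σ * ‖u‖ ^ 2 := by
    have e : inner ℝ (u - q) q = (0 : ℝ) := Submodule.starProjection_inner_eq_zero u q hqV
    rw [inner_sub_left, real_inner_self_eq_norm_sq] at e
    linarith
  have hσ : 0 ≤ σ := by
    by_contra! hneg
    nlinarith [sq_nonneg ‖q‖, mul_pos_of_neg_of_neg hneg (neg_neg_of_pos (pow_pos hpos 2))]
  by_cases hσ₁ : σ = 1
  · left
    have e : ‖u - q‖ ^ 2 = 0 := by
      rw [norm_sub_sq_real, huq, hqq, hσ₁]; ring
    have e' : u = q := sub_eq_zero.1 (norm_eq_zero.1 (pow_eq_zero_iff two_ne_zero |>.1 e))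
    exact ⟨hu, e' ▸ hqV⟩
  · right
    refine ⟨√σ, Real.sqrt_nonneg _, ?_, (Real.sq_sqrt hσ).symm⟩
    have hqy : ∀ y ∈ U ⊓ V, inner ℝ y q = inner ℝ y u := fun y hy => by
      have e : inner ℝ (u - q) y = (0 : ℝ) := Submodule.starProjection_inner_eq_zero u y hy.2
      rw [inner_sub_left] at e
      rw [real_inner_comm, real_inner_comm u]; linarith
    have huy : ∀ y ∈ U ⊓ V, inner ℝ y u = 0 := fun y hy => by
      have e : inner ℝ (q - U.starProjection q) y = (0 : ℝ) :=
        Submodule.starProjection_inner_eq_zero q y hy.1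
      rw [h, inner_sub_left, inner_smul_left, real_inner_comm, hqy y hy, real_inner_comm y u] at e
      have : (1 - σ) * inner ℝ y u = 0 := by
        simp only [conj_trivial] at e; linarith
      exact (mul_eq_zero.1 this).resolve_left (sub_ne_zero.2 (Ne.symm hσ₁))
    rcases hσ.eq_or_lt with rfl | hσ₀
    · simpa using friedrichsCos_nonneg U V
    have hs : 0 < √σ := Real.sqrt_pos.2 hσ₀
    have hnq : ‖q‖ = √σ * ‖u‖ := by
      rw [← Real.sqrt_sq (norm_nonneg q), hqq, Real.sqrt_mul hσ, Real.sqrt_sq hpos.le]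
    have key := inner_le_friedrichsCos (U := U) (V := V) (u := ‖u‖⁻¹ • u) (v := ‖q‖⁻¹ • q)
      (Submodule.smul_mem _ _ ⟨hu, (Submodule.mem_orthogonal _ _).2 huy⟩)
      (Submodule.smul_mem _ _ ⟨hqV, (Submodule.mem_orthogonal _ _).2 fun y hy =>
        (hqy y hy).trans (huy y hy)⟩)
      (by rw [norm_smul, norm_inv, norm_norm, inv_mul_cancel₀ hpos.ne'])
      (by rw [norm_smul, norm_inv, norm_norm, inv_mul_cancel₀ (by rw [hnq]; positivity)])
    refine le_trans (le_of_eq ?_) key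
    rw [inner_smul_left, inner_smul_right, huq, hnq]
    simp only [conj_trivial]
    field_simp
    exact Real.sq_sqrt hσ

/-- Eigenvectors of the symmetric `P_U P_V P_U` span the space, and `P_U` sends each to zero or a
principal vector. -/
theorem le_of_principal_vectors [FiniteDimensional ℝ E] {D : Submodule ℝ E}
    (h : ∀ u ∈ U, ∀ σ : ℝ, u ≠ 0 → U.starProjection (V.starProjection u) = σ • u → u ∈ D) :
    U ≤ D := by
  let P : E →ₗ[ℝ] E := U.starProjection
  let Q : E →ₗ[ℝ] E := V.starProjection
  have hP : P.IsSymmetric := Submodule.starProjection_isSymmetric _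
  have hQ : Q.IsSymmetric := Submodule.starProjection_isSymmetric _
  have hS : (P ∘ₗ Q ∘ₗ P).IsSymmetric := fun x y => by
    simp only [LinearMap.comp_apply]
    rw [hP, hQ, hP]
  have htop := Submodule.orthogonal_eq_bot_iff.1 hS.orthogonalComplement_iSup_eigenspaces_eq_bot
  have hle : (⊤ : Submodule ℝ E) ≤ D.comap P := by
    rw [← htop]
    refine iSup_le fun σ e he => ?_
    rw [Submodule.mem_comap]
    by_cases h0 : P e = 0
    · rw [h0]; exact D.zero_mem
    refine h (P e) (Submodule.starProjection_apply_mem U e) σ h0 ?_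
    have he' : P (Q (P e)) = σ • e := Module.End.mem_eigenspace_iff.1 he
    calc U.starProjection (V.starProjection (P e)) = P (Q (P e)) := rfl
      _ = P (P (Q (P e))) := (starProjection_starProjection U _).symm
      _ = σ • P e := by rw [he', map_smul]
  intro u hu
  have := hle (Submodule.mem_top (x := u))
  rwa [Submodule.mem_comap, show P u = u from Submodule.starProjection_eq_self_iff.2 hu] at this

theorem sup_le_decaySubmodule [FiniteDimensional ℝ E] (hα₀ : 0 < α) (hα₁ : α ≤ 1) (hβ₀ : 0 < β)
    (hβ₁ : β < 1) {r : ℝ} (hr : rate α β (friedrichsCos U V) < r) :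
    U ⊔ V ≤ decaySubmodule (aamrLinear U V α β) r := by
  have hC := friedrichsCos_nonneg U V
  have hr₀ : 0 ≤ r := (rate_nonneg hα₀ hα₁ hβ₀ hβ₁ hC).trans hr.le
  have hinf : ∀ w ∈ U ⊓ V, w ∈ decaySubmodule (aamrLinear U V α β) r := fun w hw =>
    mem_decaySubmodule_of_eigenvector
      (by
        rw [abs_of_nonneg (intersection_eigenvalue_nonneg hα₁ hβ₀ hβ₁)]
        exact (intersection_eigenvalue_le_rate hα₀ hα₁ hβ₀ hβ₁ hC).trans_lt hr)
      (aamrLinear_apply_of_mem_inf hw)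
  have hplane : ∀ c, 0 ≤ c → c ≤ friedrichsCos U V → ∀ w : E,
      aamrLinear U V α β (aamrLinear U V α β w) =
        (2 * (1 + 2 * α * β * (β * c ^ 2 - 1))) • aamrLinear U V α β w -
        (4 * (1 - α) * α * β ^ 2 * c ^ 2 + (1 - 2 * α * β) ^ 2) • w →
      w ∈ decaySubmodule (aamrLinear U V α β) r := fun c hc hcC w hw => by
    refine mem_decaySubmodule_of_roots hr₀ ?_ hw
    rcases principal_plane_roots hα₀ hα₁ hβ₀ hβ₁ hc hcC rfl rfl with ⟨h1, h2⟩ | ⟨s, hs, h1, h2⟩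
    · exact Or.inl ⟨h1, h2.trans (pow_le_pow_left₀ (rate_nonneg hα₀ hα₁ hβ₀ hβ₁ hC) hr.le 2)⟩
    · exact Or.inr ⟨s, hs, h1.trans_lt hr, h2.trans_lt hr⟩
  refine sup_le (le_of_principal_vectors (V := V) fun u hu σ hu₀ h => ?_)
    (le_of_principal_vectors (V := U) fun v hv σ hv₀ h => ?_)
  · rcases principal_cosine_cases hu hu₀ h with h1 | ⟨c, hc, hcC, rfl⟩
    · exact hinf u h1
    · exact hplane c hc hcC u (aamrLinear_quadratic_left hu h)
  · rcases principal_cosine_cases hv hv₀ h with h1 | ⟨c, hc, hcC, rfl⟩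
    · exact hinf v (inf_comm V U ▸ h1)
    · exact hplane c hc (friedrichsCos_comm U V ▸ hcC) v (aamrLinear_quadratic_right hv h)

end Linear

/-! ### Translated subspaces and fixed points. -/

section Affine

variable {E : Type*} [NormedAddCommGroup E] [InnerProductSpace ℝ E]

theorem isBestApprox_of_sub_mem_orthogonal {K : Submodule ℝ E} {C : Set E} {x p : E}
    (hp : p ∈ C) (hC : ∀ c ∈ C, c - p ∈ K) (h : x - p ∈ Kᗮ) : IsBestApprox C x p := by
  refine ⟨hp, fun c hc => ?_⟩
  have h1 : inner ℝ (x - p) (c - p) = (0 : ℝ) :=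
    Submodule.inner_left_of_mem_orthogonal (hC c hc) h
  have h2 := norm_sub_sq_real (x - p) (c - p)
  rw [sub_sub_sub_cancel_right, h1] at h2
  exact le_of_sq_le_sq (by nlinarith [sq_nonneg ‖c - p‖]) (norm_nonneg _)

theorem projector_coe (U : Submodule ℝ E) [U.HasOrthogonalProjection] (x : E) :
    projector (U : Set E) x = U.starProjection x :=
  (IsBestApprox.eq_projector U.convex (isBestApprox_of_sub_mem_orthogonal (K := U)
    (Submodule.starProjection_apply_mem U x)
    (fun _ hc => U.sub_mem hc (Submodule.starProjection_apply_mem U x))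
    (Submodule.sub_starProjection_mem_orthogonal x))).symm

theorem projector_translate (U : Submodule ℝ E) [U.HasOrthogonalProjection] (z x : E) :
    projector (translate (U : Set E) z) x = U.starProjection (x + z) - z := by
  have hcv : Convex ℝ (translate (U : Set E) z) := by
    have := U.convex.translate (-z)
    simpa only [translate, neg_add_eq_sub] using this
  refine (IsBestApprox.eq_projector hcv (isBestApprox_of_sub_mem_orthogonal (K := U)
    ⟨_, Submodule.starProjection_apply_mem U (x + z), rfl⟩ ?_ ?_)).symm
  · rintro _ ⟨c, hc, rfl⟩
    rw [sub_sub_sub_cancel_right]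
    exact U.sub_mem hc (Submodule.starProjection_apply_mem U _)
  · rw [sub_sub_eq_add_sub]
    exact Submodule.sub_starProjection_mem_orthogonal (x + z)

variable (U V : Submodule ℝ E) [U.HasOrthogonalProjection] [V.HasOrthogonalProjection]

theorem aamr_translate_apply (z x : E) (α β : ℝ) :
    aamr (translate (U : Set E) z) (translate (V : Set E) z) α β x =
      (1 - α) • x + α • ((2 * β) • (V.starProjection
        (((2 * β) • (U.starProjection (x + z) - z) - x) + z) - z) -
          ((2 * β) • (U.starProjection (x + z) - z) - x)) := by
  simp only [aamr, modifiedReflection, projector_translate]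

theorem aamr_translate_sub (z x y : E) (α β : ℝ) :
    aamr (translate (U : Set E) z) (translate (V : Set E) z) α β x -
      aamr (translate (U : Set E) z) (translate (V : Set E) z) α β y =
        aamrLinear U V α β (x - y) := by
  simp only [aamr_translate_apply, aamrLinear_apply, map_sub, map_add, map_smul]
  module

theorem exists_fixedPoint [FiniteDimensional ℝ E] (z : E) (α β : ℝ) :
    ∃ f, aamr (translate (U : Set E) z) (translate (V : Set E) z) α β f = f ∧
      U.starProjection (z + f) = (U ⊓ V).starProjection z := by
  set q := (U ⊓ V).starProjection z with hq
  have hqm : q ∈ U ⊓ V := Submodule.starProjection_apply_mem _ z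
  have hzq : z - q ∈ Uᗮ ⊔ Vᗮ := by
    have : (Uᗮ ⊔ Vᗮ)ᗮ = U ⊓ V := by
      rw [← Submodule.inf_orthogonal, Submodule.orthogonal_orthogonal,
        Submodule.orthogonal_orthogonal]
    rw [← Submodule.orthogonal_orthogonal (Uᗮ ⊔ Vᗮ), this]
    exact Submodule.sub_starProjection_mem_orthogonal z
  obtain ⟨a, ha, b, hb, hab⟩ := Submodule.mem_sup.1 hzq
  have hz : z = q + a + b := by rw [add_assoc, hab]; abel
  -- The fixed point `(1 - 2 β) a - b` is chosen so that both projections equal `q`, with residuals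
  -- `(2 - 2 β) a` and `(2 - 2 β) b`.
  have hU : U.starProjection ((1 - 2 * β) • a - b + z) = q :=
    Submodule.eq_starProjection_of_mem_orthogonal' (z := (2 - 2 * β) • a) hqm.1
      (Uᗮ.smul_mem _ ha) (by rw [hz]; module)
  refine ⟨(1 - 2 * β) • a - b, ?_, by rw [add_comm]; exact hU⟩
  have hV : V.starProjection (((2 * β) • (q - z) - ((1 - 2 * β) • a - b)) + z) = q :=
    Submodule.eq_starProjection_of_mem_orthogonal' (z := (2 - 2 * β) • b) hqm.2
      (Vᗮ.smul_mem _ hb) (by rw [hz]; module)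
  rw [aamr_translate_apply, hU, hV]
  module

end Affine

end AAMR

/-! ### The convergence theorem. -/

theorem corollary3p3 {n : ℕ} (U V : Submodule ℝ (EuclideanSpace ℝ (Fin n)))
    (α β : ℝ) (hα₀ : 0 < α) (hα₁ : α ≤ 1) (hβ₀ : 0 < β) (hβ₁ : β < 1)
    (z : EuclideanSpace ℝ (Fin n)) (T : EuclideanSpace ℝ (Fin n) → EuclideanSpace ℝ (Fin n))
    (hT : T = AAMR.aamr (AAMR.translate (U : Set (EuclideanSpace ℝ (Fin n))) z)
      (AAMR.translate (V : Set (EuclideanSpace ℝ (Fin n))) z) α β)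
    (x : ℕ → EuclideanSpace ℝ (Fin n)) (hx : ∀ k, x (k + 1) = T (x k)) :
    AAMR.rate α β (AAMR.friedrichsCos U V) < 1 ∧
    (∃! p, AAMR.IsBestApprox (Function.fixedPoints T) (x 0) p) ∧
    ∀ μ : ℝ, AAMR.rate α β (AAMR.friedrichsCos U V) < μ → μ < 1 →
      ∃ k₀ : ℕ, 0 < k₀ ∧ ∀ k, k₀ ≤ k →
        ‖AAMR.projector (U : Set (EuclideanSpace ℝ (Fin n))) (z + x k) -
            AAMR.projector ((U : Set (EuclideanSpace ℝ (Fin n))) ∩ V) z‖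
          ≤ ‖x k - AAMR.projector (Function.fixedPoints T) (x 0)‖ ∧
        ‖x k - AAMR.projector (Function.fixedPoints T) (x 0)‖ ≤ μ ^ k := by
  have hsub : ∀ y w, T y - T w = AAMR.aamrLinear U V α β (y - w) := fun y w => by
    rw [hT]; exact AAMR.aamr_translate_sub U V z y w α β
  obtain ⟨f, hf, hfU⟩ := AAMR.exists_fixedPoint U V z α β
  rw [← hT] at hf
  have hmem : ∀ y, y ∈ Function.fixedPoints T ↔ y - f ∈ Uᗮ ⊓ Vᗮ := fun y => by
    have h1 := hsub y f
    rw [hf] at h1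
    constructor
    · intro hy
      rw [show T y = y from hy] at h1
      exact AAMR.mem_orthogonal_of_aamrLinear_eq_self hα₀ hβ₀ hβ₁ h1.symm
    · intro hy
      rw [AAMR.aamrLinear_apply_of_mem_orthogonal hy.1 hy.2] at h1
      exact sub_left_injective h1
  have hconv : Convex ℝ (Function.fixedPoints T) := by
    have : Function.fixedPoints T = (fun y => y + f) '' ((Uᗮ ⊓ Vᗮ : Submodule ℝ _) : Set _) := by
      ext y
      rw [hmem]
      exact ⟨fun h => ⟨y - f, h, sub_add_cancel y f⟩, by rintro ⟨w, hw, rfl⟩; simpa using hw⟩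
    rw [this]
    simpa only [add_comm] using (Uᗮ ⊓ Vᗮ).convex.translate f
  set K := Uᗮ ⊓ Vᗮ with hK
  set p := f + K.starProjection (x 0 - f) with hp
  have hpf : p - f ∈ K := by
    rw [hp, add_sub_cancel_left]; exact Submodule.starProjection_apply_mem K _
  have hpfix : T p = p := (hmem p).2 hpf
  have hx0 : x 0 - p ∈ Kᗮ := by
    rw [hp, ← sub_sub]; exact Submodule.sub_starProjection_mem_orthogonal _
  have hbest : AAMR.IsBestApprox (Function.fixedPoints T) (x 0) p :=
    AAMR.isBestApprox_of_sub_mem_orthogonal (K := K) hpfix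
      (fun c hc => by simpa using K.sub_mem ((hmem c).1 hc) hpf) hx0
  have hpp : AAMR.projector (Function.fixedPoints T) (x 0) = p := (hbest.eq_projector hconv).symm
  have hpU : U.starProjection (z + p) = (U ⊓ V).starProjection z := by
    rw [← hfU, show z + p = z + f + (p - f) by abel, map_add,
      (Submodule.starProjection_apply_eq_zero_iff _).2 hpf.1, add_zero]
  have hiter : ∀ k, x k - p = (AAMR.aamrLinear U V α β ^ k) (x 0 - p) := fun k => by
    induction k with
    | zero => simp
    | succ k ih =>
      rw [pow_succ', Module.End.mul_apply, ← ih, ← hsub, hpfix, hx]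
  refine ⟨AAMR.rate_lt_one hα₀ hα₁ hβ₀ hβ₁ (AAMR.friedrichsCos_nonneg U V)
    (AAMR.friedrichsCos_lt_one U V),
    ⟨p, hbest, fun y hy => (hy.eq_projector hconv).trans hpp⟩, fun μ hμ _ => ?_⟩
  -- The slack between `r` and `μ` absorbs the constant in the orbit bound.
  obtain ⟨r, hr, hrμ⟩ := exists_between hμ
  have hr₀ : 0 ≤ r :=
    (AAMR.rate_nonneg hα₀ hα₁ hβ₀ hβ₁ (AAMR.friedrichsCos_nonneg U V)).trans hr.le
  have hUV : x 0 - p ∈ U ⊔ V := by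
    rwa [hK, Submodule.inf_orthogonal, Submodule.orthogonal_orthogonal] at hx0
  obtain ⟨C, hC⟩ := AAMR.sup_le_decaySubmodule hα₀ hα₁ hβ₀ hβ₁ hr hUV
  have hlim : ∀ᶠ k : ℕ in Filter.atTop, ‖C * r ^ k‖ ≤ 1 * ‖μ ^ k‖ :=
    ((isLittleO_pow_pow_of_lt_left hr₀ hrμ).const_mul_left C).def one_pos
  obtain ⟨k₀, hk₀⟩ := Filter.eventually_atTop.1 hlim
  refine ⟨k₀ + 1, k₀.succ_pos, fun k hk => ?_⟩
  rw [hpp]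
  constructor
  · rw [AAMR.projector_coe, ← Submodule.coe_inf, AAMR.projector_coe, ← hpU, ← map_sub,
      add_sub_add_left_eq_sub]
    exact Submodule.norm_starProjection_apply_le U _
  · have h1 := hk₀ k (by omega)
    have hμ₀ : 0 ≤ μ ^ k := pow_nonneg (hr₀.trans hrμ.le) k
    rw [one_mul, Real.norm_of_nonneg hμ₀] at h1
    rw [hiter]
    exact (hC k).trans ((le_abs_self _).trans h1)
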